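/- Let $\Omega\subset\mathbb{R}^n$ be a bounded Lipschitz domain (a nonempty bounded open set with Lipschitz boundary), and let $V:=H^1(\Omega)$ with $\|u\|_V^2=\|u\|_{L^2(\Omega)}^2+\|\nabla u\|_{L^2(\Omega)}^2$, with dual $V^*$ and duality pairing $\langle\cdot,\cdot\rangle$. Let $f\in L^2(\Omega)$ (identified with $v\mapsto\int_\Omega fv$ in $V^*$), $h\in H^{1/2}(\partial\Omega)$ and $\psi\in V$ with $\psi\le h$ on $\partial\Omega$ in the sense of traces, and put $$K:=\{u\in V : u\ge\psi \text{ a.e. in }\Omega,\ u=h\text{ on }\partial\Omega\}.$$ Let $A\colon V\to V^*$ be an operator (for instance $A=-\Delta+\sum_i b_i\partial_{x_i}+k\,\mathrm{Id}$ with constants $b_i, k\ge 0$) and $C_a,C_b>0$ constants such that, for all $u,v\in K$, $$\|Au-Av\|_{V^*}\le C_b\|u-v\|_V,\qquad \langle Au-Av,u-v\rangle\ge C_a\|u-v\|_V^2 .$$ Let $u^*\in K$ solve the variational inequality $\langle Au^*-f,u^*-v\rangle\le 0$ for all $v\in K$. Let $X,Y\subset V$ be sets such that $u^*\in X\cap Y$,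 $K\cap X\subset K\cap Y$, and $K\cap Y$ is convex and closed in $V$. For $\gamma>0$ and $u\in V$ let $$G_\gamma(u):=\sup_{v\in K\cap Y}\Big(\langle Au-f,u-v\rangle-\frac1{2\gamma}\|u-v\|_V^2\Big).$$ Then this supremum is finite for every $u\in V$, and the following hold. (a) If the coercivity inequality $\langle Au-Av,u-v\rangle\ge C_a\|u-v\|_V^2$ holds for all $u,v\in V$, then $$\Big(C_a-\frac1{2\gamma}\Big)\|u-u^*\|_V^2+\langle Au^*-f,u-u^*\rangle\le G_\gamma(u)\qquad\text{for all }u\in V.$$ (b) For every $u\in K$ (with coercivity on $K$ only) the inequality in (a) holds, and the duality term can be omitted: $$\Big(C_a-\frac1{2\gamma}\Big)\|u-u^*\|_V^2\le G_\gamma(u).$$ In particular, if $\gamma>\frac1{2C_a}$, then $C_a-\frac1{2\gamma}>0$ and $\|u-u^*\|_V^2\le\big(C_a-\frac1{2\gamma}\big)^{-1}G_\gamma(u)$ for all $u\in K$. -/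

import Mathlib

open MeasureTheory Filter Topology Set
open scoped ENNReal NNReal ContDiff

noncomputable section

/-! ### Bounded Lipschitz domains and the Sobolev space `H¹(Ω)` -/

/-- A bounded Lipschitz domain of `ℝⁿ`: a nonempty bounded open set which, near each of its boundary
points, is the strict epigraph of a Lipschitz function in the direction of some unit vector `ν`.
(The function `φ` is only evaluated on the hyperplane orthogonal to `ν`.) -/
structure IsBoundedLipschitzDomain {n : ℕ} (Ω : Set (EuclideanSpace ℝ (Fin n))) : Prop where
  isOpen : IsOpen Ω
  nonempty : Ω.Nonempty
  isBounded : Bornology.IsBounded Ω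
  lipschitz_boundary : ∀ x ∈ frontier Ω,
    ∃ ν : EuclideanSpace ℝ (Fin n), ‖ν‖ = 1 ∧
    ∃ (L : ℝ≥0) (φ : EuclideanSpace ℝ (Fin n) → ℝ), LipschitzWith L φ ∧
    ∃ U ∈ 𝓝 x, ∀ y ∈ U, (y ∈ Ω ↔ φ (y - inner ℝ ν y • ν) < inner ℝ ν y)

/-- `g` is the weak gradient of `u` on `Ω`:
`∫_Ω u ∂ᵢφ = - ∫_Ω gᵢ φ` for all `i` and all `φ ∈ C_c^∞(Ω)`. -/
def IsWeakGradient {n : ℕ} (Ω : Set (EuclideanSpace ℝ (Fin n)))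
    (u : EuclideanSpace ℝ (Fin n) → ℝ)
    (g : EuclideanSpace ℝ (Fin n) → EuclideanSpace ℝ (Fin n)) : Prop :=
  ∀ φ : EuclideanSpace ℝ (Fin n) → ℝ, ContDiff ℝ ∞ φ → HasCompactSupport φ → tsupport φ ⊆ Ω →
    ∀ i : Fin n,
      ∫ x in Ω, u x * fderiv ℝ φ x (EuclideanSpace.single i 1) = - ∫ x in Ω, g x i * φ x

/-- The space `L²(Ω)` of real-valued functions. -/
abbrev L2 {n : ℕ} (Ω : Set (EuclideanSpace ℝ (Fin n))) : Type :=
  Lp ℝ 2 (volume.restrict Ω)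

/-- The space `L²(Ω)ⁿ` of vector fields. -/
abbrev L2Vec {n : ℕ} (Ω : Set (EuclideanSpace ℝ (Fin n))) : Type :=
  Lp (EuclideanSpace ℝ (Fin n)) 2 (volume.restrict Ω)

theorem integrable_mul_of_test {n : ℕ} {Ω : Set (EuclideanSpace ℝ (Fin n))}
    {u θ : EuclideanSpace ℝ (Fin n) → ℝ} (hu : MemLp u 2 (volume.restrict Ω))
    (hθ : Continuous θ) (hc : HasCompactSupport θ) :
    Integrable (fun x => u x * θ x) (volume.restrict Ω) :=
  hu.integrable_mul (hθ.memLp_of_hasCompactSupport (p := 2) hc)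

theorem memLp_coord {n : ℕ} {Ω : Set (EuclideanSpace ℝ (Fin n))} (g : L2Vec Ω) (i : Fin n) :
    MemLp (fun x => g x i) 2 (volume.restrict Ω) :=
  (EuclideanSpace.proj (𝕜 := ℝ) i).comp_memLp' (Lp.memLp g)

theorem continuous_test_deriv {n : ℕ} {φ : EuclideanSpace ℝ (Fin n) → ℝ}
    (hφ : ContDiff ℝ ∞ φ) (v : EuclideanSpace ℝ (Fin n)) :
    Continuous (fun x => fderiv ℝ φ x v) :=
  (hφ.continuous_fderiv (by simp)).clm_apply continuous_const

theorem hasCompactSupport_test_deriv {n : ℕ} {φ : EuclideanSpace ℝ (Fin n) → ℝ}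
    (hc : HasCompactSupport φ) (v : EuclideanSpace ℝ (Fin n)) :
    HasCompactSupport (fun x => fderiv ℝ φ x v) :=
  hc.fderiv_apply (𝕜 := ℝ) v

/-- The pairs `(u, ∇u)` with `u ∈ L²(Ω)` having a weak gradient `∇u ∈ L²(Ω)ⁿ`,
as a linear subspace of the Hilbert space `L²(Ω) × L²(Ω)ⁿ`. -/
def h1Submodule {n : ℕ} (Ω : Set (EuclideanSpace ℝ (Fin n))) :
    Submodule ℝ (WithLp 2 (L2 Ω × L2Vec Ω)) where
  carrier := {p | IsWeakGradient Ω p.fst p.snd}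
  zero_mem' := by
    intro φ _ _ _ i
    have h1 : ∫ x in Ω, (((0 : WithLp 2 (L2 Ω × L2Vec Ω)).fst : L2 Ω) x) *
        fderiv ℝ φ x (EuclideanSpace.single i 1) = 0 := by
      apply integral_eq_zero_of_ae
      filter_upwards [Lp.coeFn_zero ℝ 2 (volume.restrict Ω)] with x hx
      rw [WithLp.zero_fst, hx]
      simp
    have h2 : ∫ x in Ω, (((0 : WithLp 2 (L2 Ω × L2Vec Ω)).snd : L2Vec Ω) x) i * φ x = 0 := by
      apply integral_eq_zero_of_ae
      filter_upwards [Lp.coeFn_zero (EuclideanSpace ℝ (Fin n)) 2 (volume.restrict Ω)] with x hx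
      rw [WithLp.zero_snd, hx]
      simp
    rw [h1, h2, neg_zero]
  add_mem' := by
    intro p q hp hq φ hφ hc hs i
    have e1 : ∫ x in Ω, ((p + q).fst : L2 Ω) x * fderiv ℝ φ x (EuclideanSpace.single i 1) =
        ∫ x in Ω, (p.fst x * fderiv ℝ φ x (EuclideanSpace.single i 1) +
          q.fst x * fderiv ℝ φ x (EuclideanSpace.single i 1)) := by
      apply integral_congr_ae
      filter_upwards [Lp.coeFn_add p.fst q.fst] with x hx
      rw [WithLp.add_fst, hx, Pi.add_apply, add_mul]
    have e2 : ∫ x in Ω, ((p + q).snd : L2Vec Ω) x i * φ x =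
        ∫ x in Ω, (p.snd x i * φ x + q.snd x i * φ x) := by
      apply integral_congr_ae
      filter_upwards [Lp.coeFn_add p.snd q.snd] with x hx
      rw [WithLp.add_snd, hx, Pi.add_apply, PiLp.add_apply, add_mul]
    rw [e1, e2, integral_add, integral_add, hp φ hφ hc hs i, hq φ hφ hc hs i, neg_add]
    · exact integrable_mul_of_test (memLp_coord p.snd i) hφ.continuous hc
    · exact integrable_mul_of_test (memLp_coord q.snd i) hφ.continuous hc
    · exact integrable_mul_of_test (Lp.memLp p.fst) (continuous_test_deriv hφ _)
        (hasCompactSupport_test_deriv hc _)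
    · exact integrable_mul_of_test (Lp.memLp q.fst) (continuous_test_deriv hφ _)
        (hasCompactSupport_test_deriv hc _)
  smul_mem' := by
    intro c p hp φ hφ hc hs i
    have e1 : ∫ x in Ω, ((c • p).fst : L2 Ω) x * fderiv ℝ φ x (EuclideanSpace.single i 1) =
        c * ∫ x in Ω, p.fst x * fderiv ℝ φ x (EuclideanSpace.single i 1) := by
      rw [← integral_const_mul]
      apply integral_congr_ae
      filter_upwards [Lp.coeFn_smul c p.fst] with x hx
      rw [WithLp.smul_fst, hx, Pi.smul_apply, smul_eq_mul, mul_assoc]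
    have e2 : ∫ x in Ω, ((c • p).snd : L2Vec Ω) x i * φ x =
        c * ∫ x in Ω, p.snd x i * φ x := by
      rw [← integral_const_mul]
      apply integral_congr_ae
      filter_upwards [Lp.coeFn_smul c p.snd] with x hx
      rw [WithLp.smul_snd, hx, Pi.smul_apply, PiLp.smul_apply, smul_eq_mul, mul_assoc]
    rw [e1, e2, hp φ hφ hc hs i, mul_neg]

/-- The Sobolev space `V = H¹(Ω)`, with the inner product
`(u, v) = ∫_Ω u v + ∫_Ω ∇u · ∇v` and the norm `‖u‖² = ‖u‖²_{L²} + ‖∇u‖²_{L²}` inherited from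
`L²(Ω) × L²(Ω)ⁿ`. -/
abbrev H1 {n : ℕ} (Ω : Set (EuclideanSpace ℝ (Fin n))) : Type := ↥(h1Submodule Ω)

/-- The function underlying an element of `H¹(Ω)`. -/
def H1.val {n : ℕ} {Ω : Set (EuclideanSpace ℝ (Fin n))} (u : H1 Ω) : L2 Ω :=
  (u : WithLp 2 (L2 Ω × L2Vec Ω)).fst

/-- The weak gradient of an element of `H¹(Ω)`. -/
def H1.grad {n : ℕ} {Ω : Set (EuclideanSpace ℝ (Fin n))} (u : H1 Ω) : L2Vec Ω :=
  (u : WithLp 2 (L2 Ω × L2Vec Ω)).snd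

theorem H1.norm_sq {n : ℕ} {Ω : Set (EuclideanSpace ℝ (Fin n))} (u : H1 Ω) :
    ‖u‖ ^ 2 = ‖u.val‖ ^ 2 + ‖u.grad‖ ^ 2 :=
  WithLp.prod_norm_sq_eq_of_L2 (u : WithLp 2 (L2 Ω × L2Vec Ω))

/-- A function `f ∈ L²(Ω)` as the element `v ↦ ∫_Ω f v` of the dual space `V*` of `V = H¹(Ω)`. -/
def l2Functional {n : ℕ} {Ω : Set (EuclideanSpace ℝ (Fin n))} (f : L2 Ω) :
    StrongDual ℝ (H1 Ω) :=
  (innerSL ℝ f).comp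
    ((WithLp.fstL 2 ℝ (L2 Ω) (L2Vec Ω)).comp (h1Submodule Ω).subtypeL)

theorem l2Functional_apply {n : ℕ} {Ω : Set (EuclideanSpace ℝ (Fin n))} (f : L2 Ω) (v : H1 Ω) :
    l2Functional f v = ∫ x in Ω, f x * v.val x := by
  change inner ℝ f v.val = _
  rw [L2.inner_def]
  simp [mul_comm]

/-! ### Boundary values -/

/-- The surface measure on `∂Ω`. -/
def surfaceMeasure {n : ℕ} (Ω : Set (EuclideanSpace ℝ (Fin n))) :
    Measure (EuclideanSpace ℝ (Fin n)) :=
  (μHE[n - 1]).restrict (frontier Ω)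

/-- `u ∈ H¹(Ω)` has the boundary value (trace) `g ∈ L²(∂Ω)`: there are smooth functions `φₖ` on
`ℝⁿ` whose restrictions to `Ω` converge to `u` in `H¹(Ω)` and whose restrictions to `∂Ω` converge
to `g` in `L²(∂Ω)`. On bounded Lipschitz domains this is the graph of the trace operator. -/
def HasTrace {n : ℕ} {Ω : Set (EuclideanSpace ℝ (Fin n))} (u : H1 Ω)
    (g : Lp ℝ 2 (surfaceMeasure Ω)) : Prop :=
  ∃ φ : ℕ → EuclideanSpace ℝ (Fin n) → ℝ, (∀ k, ContDiff ℝ ∞ (φ k)) ∧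
    Tendsto (fun k => eLpNorm (fun x => φ k x - u.val x) 2 (volume.restrict Ω)) atTop (𝓝 0) ∧
    Tendsto (fun k => eLpNorm (fun x => gradient (φ k) x - u.grad x) 2 (volume.restrict Ω))
      atTop (𝓝 0) ∧
    Tendsto (fun k => eLpNorm (fun x => φ k x - g x) 2 (surfaceMeasure Ω)) atTop (𝓝 0)

/-- `h ∈ L²(∂Ω)` belongs to `H^{1/2}(∂Ω)`: its Gagliardo seminorm
`∫_{∂Ω} ∫_{∂Ω} |h(x) - h(y)|² / |x - y|ⁿ dσ(y) dσ(x)` is finite. -/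
def MemHHalf {n : ℕ} {Ω : Set (EuclideanSpace ℝ (Fin n))}
    (h : Lp ℝ 2 (surfaceMeasure Ω)) : Prop :=
  ∫⁻ x, ∫⁻ y, ‖h x - h y‖ₑ ^ 2 / ‖x - y‖ₑ ^ n ∂(surfaceMeasure Ω) ∂(surfaceMeasure Ω) < ⊤

/-! ### The obstacle problem and the regularised gap function -/

/-- The constraint set `K = {u ∈ H¹(Ω) : u ≥ ψ a.e. in Ω, u = h on ∂Ω}`. -/
def constraintSet {n : ℕ} {Ω : Set (EuclideanSpace ℝ (Fin n))} (ψ : H1 Ω)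
    (h : Lp ℝ 2 (surfaceMeasure Ω)) : Set (H1 Ω) :=
  {u | (∀ᵐ x ∂(volume.restrict Ω), ψ.val x ≤ u.val x) ∧ HasTrace u h}

/-- Lipschitz continuity on `S` of an operator `A : V → V*`, with constant `C`. -/
def IsLipschitzOperatorOn {n : ℕ} {Ω : Set (EuclideanSpace ℝ (Fin n))}
    (A : H1 Ω → StrongDual ℝ (H1 Ω)) (C : ℝ) (S : Set (H1 Ω)) : Prop :=
  ∀ u ∈ S, ∀ v ∈ S, ‖A u - A v‖ ≤ C * ‖u - v‖

/-- Coercivity on `S` of an operator `A : V → V*`, with constant `C`: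
`⟨Au - Av, u - v⟩ ≥ C ‖u - v‖²` for all `u, v ∈ S`. -/
def IsCoerciveOperatorOn {n : ℕ} {Ω : Set (EuclideanSpace ℝ (Fin n))}
    (A : H1 Ω → StrongDual ℝ (H1 Ω)) (C : ℝ) (S : Set (H1 Ω)) : Prop :=
  ∀ u ∈ S, ∀ v ∈ S, C * ‖u - v‖ ^ 2 ≤ (A u - A v) (u - v)

/-- `L(u, v) = ⟨Au - f, u - v⟩`. -/
def lagrangian {n : ℕ} {Ω : Set (EuclideanSpace ℝ (Fin n))}
    (A : H1 Ω → StrongDual ℝ (H1 Ω)) (f : L2 Ω) (u v : H1 Ω) : ℝ :=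
  (A u - l2Functional f) (u - v)

/-- `u` solves the variational inequality: `u ∈ K` and `⟨Au - f, u - v⟩ ≤ 0` for all `v ∈ K`. -/
def IsVISolution {n : ℕ} {Ω : Set (EuclideanSpace ℝ (Fin n))}
    (A : H1 Ω → StrongDual ℝ (H1 Ω)) (f : L2 Ω) (K : Set (H1 Ω)) (u : H1 Ω) : Prop :=
  u ∈ K ∧ ∀ v ∈ K, lagrangian A f u v ≤ 0

/-- `L_γ(u, v) = L(u, v) - ‖u - v‖² / (2γ)`. -/
def regLagrangian {n : ℕ} {Ω : Set (EuclideanSpace ℝ (Fin n))}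
    (A : H1 Ω → StrongDual ℝ (H1 Ω)) (f : L2 Ω) (γ : ℝ) (u v : H1 Ω) : ℝ :=
  lagrangian A f u v - 1 / (2 * γ) * ‖u - v‖ ^ 2

/-- The generalised regularised gap function `G_γ(u) = sup_{v ∈ K ∩ Y} L_γ(u, v)`. -/
def gapFunction {n : ℕ} {Ω : Set (EuclideanSpace ℝ (Fin n))}
    (A : H1 Ω → StrongDual ℝ (H1 Ω)) (f : L2 Ω) (γ : ℝ) (K Y : Set (H1 Ω)) (u : H1 Ω) : ℝ :=
  sSup (regLagrangian A f γ u '' (K ∩ Y))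

end

/-! The solution `uStar` is itself admissible in the supremum, so the value at `v = uStar` bounds
the gap function from below. Writing `A u - f = (A u - A uStar) + (A uStar - f)`, coercivity turns
the first part into `Ca * ‖u - uStar‖ ^ 2`, and the regularisation costs `1 / (2 * γ)` of the same
square: this is `le_gapFunction_of_coercive`. On `K` the remaining duality term is nonnegative by
the variational inequality (`IsVISolution.nonneg`) and can be dropped. The supremum is finite
because the quadratic penalty dominates a bounded linear functional. -/

/-- A continuous linear functional minus a positive multiple of the squared norm is bounded above. -/
theorem StrongDual.sub_sq_norm_le {E : Type*} [NormedAddCommGroup E] [NormedSpace ℝ E]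
    (l : StrongDual ℝ E) {γ : ℝ} (hγ : 0 < γ) (w : E) :
    l w - 1 / (2 * γ) * ‖w‖ ^ 2 ≤ γ / 2 * ‖l‖ ^ 2 := by
  have h1 : l w ≤ ‖l‖ * ‖w‖ := (Real.le_norm_self _).trans (l.le_opNorm w)
  -- Completing the square: `γ / 2 * ‖l‖ ^ 2` is the maximum of `‖l‖ * t - t ^ 2 / (2 * γ)` over
  -- real `t`, attained at `t = γ * ‖l‖`.
  have h2 : γ / 2 * ‖l‖ ^ 2 - (‖l‖ * ‖w‖ - 1 / (2 * γ) * ‖w‖ ^ 2)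
      = (γ * ‖l‖ - ‖w‖) ^ 2 / (2 * γ) := by
    field_simp
    ring
  have h3 : 0 ≤ (γ * ‖l‖ - ‖w‖) ^ 2 / (2 * γ) := by positivity
  linarith

/-- The bound from `StrongDual.sub_sq_norm_le` depends on `u` but not on `v`. Since a real `sSup`
takes the default value 0 on empty or unbounded sets, `IsLUB` is what expresses that the supremum is
genuine and finite. -/
theorem isLUB_gapFunction {n : ℕ} {Ω : Set (EuclideanSpace ℝ (Fin n))}
    (A : H1 Ω → StrongDual ℝ (H1 Ω)) (f : L2 Ω) {γ : ℝ} (hγ : 0 < γ) {K Y : Set (H1 Ω)}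
    (hne : (K ∩ Y).Nonempty) (u : H1 Ω) :
    IsLUB (regLagrangian A f γ u '' (K ∩ Y)) (gapFunction A f γ K Y u) := by
  refine isLUB_csSup (hne.image _) ⟨γ / 2 * ‖A u - l2Functional f‖ ^ 2, ?_⟩
  rintro _ ⟨v, -, rfl⟩
  exact StrongDual.sub_sq_norm_le _ hγ (u - v)

/-- Coercivity between `u` and a competitor `w ∈ K ∩ Y` bounds the gap function from below. -/
theorem le_gapFunction_of_coercive {n : ℕ} {Ω : Set (EuclideanSpace ℝ (Fin n))}
    {A : H1 Ω → StrongDual ℝ (H1 Ω)} (f : L2 Ω) {C γ : ℝ} (hγ : 0 < γ) {K Y : Set (H1 Ω)}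
    {u w : H1 Ω} (hw : w ∈ K ∩ Y) (hc : C * ‖u - w‖ ^ 2 ≤ (A u - A w) (u - w)) :
    (C - 1 / (2 * γ)) * ‖u - w‖ ^ 2 + (A w - l2Functional f) (u - w)
      ≤ gapFunction A f γ K Y u := by
  -- Test the supremum with `v = w`.
  refine le_trans ?_ ((isLUB_gapFunction A f hγ ⟨w, hw⟩ u).1 ⟨w, hw, rfl⟩)
  have h1 : (A u - l2Functional f) (u - w)
      = (A u - A w) (u - w) + (A w - l2Functional f) (u - w) := by
    rw [← add_apply, sub_add_sub_cancel]
  rw [regLagrangian, lagrangian, h1, sub_mul]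
  linarith

/-- The variational inequality tested with `v = u`, with the sign of the argument reversed. -/
theorem IsVISolution.nonneg {n : ℕ} {Ω : Set (EuclideanSpace ℝ (Fin n))}
    {A : H1 Ω → StrongDual ℝ (H1 Ω)} {f : L2 Ω} {K : Set (H1 Ω)} {w : H1 Ω}
    (hw : IsVISolution A f K w) {u : H1 Ω} (hu : u ∈ K) :
    0 ≤ (A w - l2Functional f) (u - w) := by
  have h1 : (A w - l2Functional f) (w - u) ≤ 0 := hw.2 u hu
  rw [← neg_sub u w, map_neg] at h1
  linarith

theorem mainTheorem3 {n : ℕ} (Ω : Set (EuclideanSpace ℝ (Fin n)))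
    (hΩ : IsBoundedLipschitzDomain Ω)
    -- boundary datum `h`, obstacle `ψ` with `ψ ≤ h` on `∂Ω`, source `f`
    (h : Lp ℝ 2 (surfaceMeasure Ω)) (hh : MemHHalf h)
    (ψ : H1 Ω)
    (hψ : ∃ g : Lp ℝ 2 (surfaceMeasure Ω), HasTrace ψ g ∧ ∀ᵐ x ∂(surfaceMeasure Ω), g x ≤ h x)
    (f : L2 Ω)
    -- the operator
    (A : H1 Ω → StrongDual ℝ (H1 Ω)) (Ca Cb : ℝ) (hCa : 0 < Ca) (hCb : 0 < Cb)
    (hLip : IsLipschitzOperatorOn A Cb (constraintSet ψ h))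
    (hcoer : IsCoerciveOperatorOn A Ca (constraintSet ψ h))
    -- the solution and the sets `X`, `Y`
    (uStar : H1 Ω) (huStar : IsVISolution A f (constraintSet ψ h) uStar)
    (X Y : Set (H1 Ω)) (hmem : uStar ∈ X ∩ Y)
    (hXY : constraintSet ψ h ∩ X ⊆ constraintSet ψ h ∩ Y)
    (hconvex : Convex ℝ (constraintSet ψ h ∩ Y))
    (hclosed : IsClosed (constraintSet ψ h ∩ Y))
    (γ : ℝ) (hγ : 0 < γ) :
    -- the supremum defining `G_γ(u)` is finite
    (∀ u : H1 Ω, IsLUB (regLagrangian A f γ u '' (constraintSet ψ h ∩ Y))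
      (gapFunction A f γ (constraintSet ψ h) Y u)) ∧
    -- the estimate on `V`, when `A` is coercive on `V`
    (IsCoerciveOperatorOn A Ca Set.univ → ∀ u : H1 Ω,
      (Ca - 1 / (2 * γ)) * ‖u - uStar‖ ^ 2 + (A uStar - l2Functional f) (u - uStar)
        ≤ gapFunction A f γ (constraintSet ψ h) Y u) ∧
    -- the estimates on `K`
    (∀ u ∈ constraintSet ψ h,
      (Ca - 1 / (2 * γ)) * ‖u - uStar‖ ^ 2 + (A uStar - l2Functional f) (u - uStar)
        ≤ gapFunction A f γ (constraintSet ψ h) Y u ∧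
      (Ca - 1 / (2 * γ)) * ‖u - uStar‖ ^ 2 ≤ gapFunction A f γ (constraintSet ψ h) Y u ∧
      (1 / (2 * Ca) < γ →
        0 < Ca - 1 / (2 * γ) ∧
        ‖u - uStar‖ ^ 2 ≤ (Ca - 1 / (2 * γ))⁻¹ * gapFunction A f γ (constraintSet ψ h) Y u)) := by
  have hm : uStar ∈ constraintSet ψ h ∩ Y := ⟨huStar.1, hmem.2⟩
  refine ⟨isLUB_gapFunction A f hγ ⟨uStar, hm⟩, fun hA u => ?_, fun u hu => ?_⟩
  · exact le_gapFunction_of_coercive f hγ hm (hA u (mem_univ u) uStar (mem_univ uStar))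
  · have h1 := le_gapFunction_of_coercive f hγ hm (hcoer u hu uStar huStar.1)
    have h2 := huStar.nonneg hu
    have h3 : (Ca - 1 / (2 * γ)) * ‖u - uStar‖ ^ 2
        ≤ gapFunction A f γ (constraintSet ψ h) Y u := by linarith
    refine ⟨h1, h3, fun hlt => ?_⟩
    -- Both the threshold on `γ` and the claim amount to `1 < 2 * Ca * γ` once the positive
    -- denominators are cleared.
    have hpos : 0 < Ca - 1 / (2 * γ) := by
      rw [div_lt_iff₀ (by positivity)] at hlt
      rw [sub_pos, div_lt_iff₀ (by positivity)]
      linarith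
    exact ⟨hpos, (le_inv_mul_iff₀ hpos).2 h3⟩
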